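/- Let $\mathcal H$ be a complex Hilbert space. For bounded self-adjoint operators on $\mathcal H$ write $A\le B$ if $B-A$ is positive, and write $A>0$ if $A$ is positive and invertible. A continuous function $f:(0,\infty)\to\mathbb R$ is called operator monotone if $f(A)\le f(B)$ whenever $0<A\le B$ are bounded operators on a complex Hilbert space (for every complex Hilbert space), where $f(A)$ is defined by the continuous functional calculus. For $\alpha\in[0,1]$ and $A>0$, $B>0$ let $$A\,\sharp_\alpha B = A^{1/2}\left(A^{-1/2}BA^{-1/2}\right)^{\alpha}A^{1/2}$$ be the $\alpha$-geometric mean, with the convention $0\,\sharp_\alpha 0=0$, and let $K(h)=\dfrac{(h+1)^2}{4h}$, $h>0$, be the Kantorovich constant. **Lemma.** Let $f$ be a non-negative operator monotone function on $(0,\infty)$, and let $A,B$ be bounded operators on $\mathcal H$ with $0<sA\le B\le tA$ for some constants $0<s\le t$. Then for all $\alpha\in[0,1]$ $$c\,f(A\,\sharp_\alpha B)\;\ge\; f\bigl(c\,(A\,\sharp_\alpha B)\bigr)\;\ge\; f(A)\,\sharp_\alpha f(B),$$ where $c=\max\{K(s)^R,K(t)^R\}$ and $R=\max\{\alpha,1-\alpha\}$.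 -/

import Mathlib

universe u

/-- A real function `f` is operator monotone on `(0, ∞)`: it is continuous there and `A ≤ B`
implies `f(A) ≤ f(B)` for all positive invertible bounded operators `A`, `B` on any complex
Hilbert space `K`.  The order is the Loewner order and `f(A)` is given by the continuous
functional calculus; only the values of `f` on `(0, ∞)` matter. -/
def IsOperatorMonotone (f : ℝ → ℝ) : Prop :=
  ContinuousOn f (Set.Ioi 0) ∧
    ∀ (K : Type u) [NormedAddCommGroup K] [InnerProductSpace ℂ K] [CompleteSpace K]
      (A B : K →L[ℂ] K), IsStrictlyPositive A → IsStrictlyPositive B → A ≤ B →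
        cfc f A ≤ cfc f B

/-- The weighted geometric mean
`A ♯_α B = A^{1/2} (A^{-1/2} B A^{-1/2})^α A^{1/2}` of bounded operators. -/
noncomputable def geomMean {H : Type u} [NormedAddCommGroup H] [InnerProductSpace ℂ H]
    [CompleteSpace H] (α : ℝ) (A B : H →L[ℂ] H) : H →L[ℂ] H :=
  A ^ (1 / 2 : ℝ) * (A ^ (-1 / 2 : ℝ) * B * A ^ (-1 / 2 : ℝ)) ^ α * A ^ (1 / 2 : ℝ)

/-- The Kantorovich constant `K(h) = (h + 1)² / (4 h)`, for `h > 0`. -/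
noncomputable def kantorovich (h : ℝ) : ℝ := (h + 1) ^ 2 / (4 * h)

/-- The constant `max {K(s)^R, K(t)^R}` with `R = max {α, 1 - α}`. -/
noncomputable def kantorovichMax (s t α : ℝ) : ℝ :=
  max (kantorovich s ^ max α (1 - α)) (kantorovich t ^ max α (1 - α))

/-! Write `G` for the geometric mean of `A` and `B`. The second inequality is a chain: f(A) ♯ f(B) ≤
(1-α) f(A) + α f(B) ≤ f((1-α)A + αB) ≤ f(cG). Its links are the operator AM-GM inequality, operator
concavity of `f`, and monotonicity of `f` applied to the reverse AM-GM inequality (1-α)A + αB ≤ cG.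
The first inequality is scalar: a non-negative concave `f` satisfies f(cx) ≤ c f(x) for c ≥ 1.

Concavity comes from monotonicity on H ⊕ H. In a rotated frame, A ⊕ B has diagonal blocks (1-w)A +
wB and wA + (1-w)B, and it is dominated by the block-diagonal operator with these blocks scaled by
1+δ and 1+δ⁻¹. Apply `f`, compress to the first block and let δ → 0. -/

open scoped InnerProductSpace InnerProduct

/-! ### Orthogonal decompositions and block-diagonal operators -/

/-- `V₁, V₂ : H → K` are isometries whose ranges are orthogonal and span `K`. -/
structure ComplementaryIsometries {H K : Type*} [NormedAddCommGroup H] [InnerProductSpace ℂ H]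
    [CompleteSpace H] [NormedAddCommGroup K] [InnerProductSpace ℂ K] [CompleteSpace K]
    (V₁ V₂ : H →L[ℂ] K) : Prop where
  adjoint_comp_fst : V₁† ∘L V₁ = 1
  adjoint_comp_snd : V₂† ∘L V₂ = 1
  adjoint_fst_comp_snd : V₁† ∘L V₂ = 0
  adjoint_snd_comp_fst : V₂† ∘L V₁ = 0
  add_eq_one : V₁ ∘L V₁† + V₂ ∘L V₂† = 1

namespace ComplementaryIsometries

variable {H K : Type*} [NormedAddCommGroup H] [InnerProductSpace ℂ H]
    [CompleteSpace H] [NormedAddCommGroup K] [InnerProductSpace ℂ K] [CompleteSpace K]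
    {V₁ V₂ : H →L[ℂ] K}

theorem adjoint_fst_apply_fst (h : ComplementaryIsometries V₁ V₂) (x : H) : (V₁†) (V₁ x) = x :=
  DFunLike.congr_fun h.adjoint_comp_fst x

theorem adjoint_snd_apply_snd (h : ComplementaryIsometries V₁ V₂) (x : H) : (V₂†) (V₂ x) = x :=
  DFunLike.congr_fun h.adjoint_comp_snd x

theorem adjoint_fst_apply_snd (h : ComplementaryIsometries V₁ V₂) (x : H) : (V₁†) (V₂ x) = 0 :=
  DFunLike.congr_fun h.adjoint_fst_comp_snd x

theorem adjoint_snd_apply_fst (h : ComplementaryIsometries V₁ V₂) (x : H) : (V₂†) (V₁ x) = 0 :=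
  DFunLike.congr_fun h.adjoint_snd_comp_fst x

/-- The block-diagonal operator `A ⊕ B` on `K`, as a star homomorphism in `(A, B)`. -/
noncomputable def blockDiag (h : ComplementaryIsometries V₁ V₂) :
    ((H →L[ℂ] H) × (H →L[ℂ] H)) →⋆ₐ[ℂ] (K →L[ℂ] K) where
  toFun p := V₁ ∘L p.1 ∘L V₁† + V₂ ∘L p.2 ∘L V₂†
  map_one' := h.add_eq_one
  map_mul' p q := by
    ext x
    simp [h.adjoint_fst_apply_fst, h.adjoint_snd_apply_snd, h.adjoint_fst_apply_snd,
      h.adjoint_snd_apply_fst]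
  map_zero' := by ext x; simp
  map_add' p q := by
    ext x
    simp only [Prod.fst_add, Prod.snd_add, add_apply,
      ContinuousLinearMap.comp_apply, map_add]
    abel
  commutes' r := by
    ext x
    have := DFunLike.congr_fun h.add_eq_one x
    simp only [add_apply, ContinuousLinearMap.comp_apply,
      one_apply_eq_self] at this
    simp [Algebra.algebraMap_eq_smul_one, ← smul_add, this]
  map_star' p := by
    simp [ContinuousLinearMap.star_eq_adjoint, ContinuousLinearMap.adjoint_comp,
      ContinuousLinearMap.comp_assoc]

theorem blockDiag_apply (h : ComplementaryIsometries V₁ V₂) (A B : H →L[ℂ] H) :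
    h.blockDiag (A, B) = V₁ ∘L A ∘L V₁† + V₂ ∘L B ∘L V₂† := rfl

theorem continuous_blockDiag (h : ComplementaryIsometries V₁ V₂) : Continuous h.blockDiag := by
  change Continuous fun p : (H →L[ℂ] H) × (H →L[ℂ] H) ↦
    V₁ ∘L p.1 ∘L V₁† + V₂ ∘L p.2 ∘L V₂†
  fun_prop

/-- The functional calculus is componentwise on a product and commutes with continuous star
homomorphisms; this is why `blockDiag` is bundled as one. -/
theorem cfc_blockDiag (h : ComplementaryIsometries V₁ V₂) (f : ℝ → ℝ) {A B : H →L[ℂ] H}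
    (hA : IsSelfAdjoint A) (hB : IsSelfAdjoint B)
    (hf : ContinuousOn f (spectrum ℝ A ∪ spectrum ℝ B)) :
    cfc f (h.blockDiag (A, B)) = h.blockDiag (cfc f A, cfc f B) := by
  have hAB : IsSelfAdjoint (A, B) := Prod.ext hA hB
  have : ContinuousFunctionalCalculus ℝ ((H →L[ℂ] H) × (H →L[ℂ] H)) IsSelfAdjoint :=
    IsSelfAdjoint.instContinuousFunctionalCalculus
  rw [← cfc_map_prod (S := ℝ) f A B hf hAB hA hB]
  exact (StarAlgHomClass.map_cfc (S := ℂ) h.blockDiag f (A, B)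
    (by rwa [Prod.spectrum_eq]) h.continuous_blockDiag hAB (hAB.map h.blockDiag)).symm

theorem blockDiag_nonneg (h : ComplementaryIsometries V₁ V₂) {A B : H →L[ℂ] H} (hA : 0 ≤ A)
    (hB : 0 ≤ B) : 0 ≤ h.blockDiag (A, B) := by
  rw [ContinuousLinearMap.nonneg_iff_isPositive] at *
  exact (hA.conj_adjoint V₁).add (hB.conj_adjoint V₂)

theorem blockDiag_isStrictlyPositive (h : ComplementaryIsometries V₁ V₂) {A B : H →L[ℂ] H}
    (hA : IsStrictlyPositive A) (hB : IsStrictlyPositive B) :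
    IsStrictlyPositive (h.blockDiag (A, B)) :=
  ((Prod.isUnit_iff.2 ⟨hA.isUnit, hB.isUnit⟩).map h.blockDiag).isStrictlyPositive
    (h.blockDiag_nonneg hA.nonneg hB.nonneg)

theorem adjoint_real_smul (r : ℝ) (V : H →L[ℂ] K) : (r • V)† = r • V† := by
  rw [← Complex.coe_smul, ← Complex.coe_smul, map_smulₛₗ, Complex.conj_ofReal]

/-- Rotating a pair of complementary isometries. -/
theorem rotate (h : ComplementaryIsometries V₁ V₂) {c s : ℝ} (hcs : c ^ 2 + s ^ 2 = 1) :
    ComplementaryIsometries (c • V₁ + s • V₂) (c • V₂ - s • V₁) := by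
  have h₁ (x : H) : (c * c) • x + (s * s) • x = x := by
    rw [← add_smul, ← sq, ← sq, hcs, one_smul]
  have h₂ (x : K) : V₁ ((V₁†) x) + V₂ ((V₂†) x) = x := DFunLike.congr_fun h.add_eq_one x
  constructor
  · ext x
    simp [adjoint_real_smul, h.adjoint_fst_apply_fst, h.adjoint_snd_apply_snd, h.adjoint_fst_apply_snd,
      h.adjoint_snd_apply_fst, smul_smul, h₁]
  · ext x
    simp [adjoint_real_smul, h.adjoint_fst_apply_fst, h.adjoint_snd_apply_snd, h.adjoint_fst_apply_snd,
      h.adjoint_snd_apply_fst, smul_smul, h₁]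
  · ext x
    simp [adjoint_real_smul, h.adjoint_fst_apply_fst, h.adjoint_snd_apply_snd, h.adjoint_fst_apply_snd,
      h.adjoint_snd_apply_fst, smul_smul, mul_comm]
  · ext x
    simp [adjoint_real_smul, h.adjoint_fst_apply_fst, h.adjoint_snd_apply_snd, h.adjoint_fst_apply_snd,
      h.adjoint_snd_apply_fst, smul_smul, mul_comm]
  · ext x
    trans (c ^ 2 + s ^ 2) • (V₁ ((V₁†) x) + V₂ ((V₂†) x))
    · simp only [adjoint_real_smul, add_apply, sub_apply, ContinuousLinearMap.comp_apply,
        smul_apply, map_add, map_sub,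
        ContinuousLinearMap.map_smul_of_tower]
      module
    · rw [hcs, h₂]; simp

end ComplementaryIsometries

/-- The ℓ² norm makes H × H a Hilbert space in the same universe as `H`, so `IsOperatorMonotone` can
be applied on it. -/
theorem complementaryIsometries_inl_inr (H : Type*) [NormedAddCommGroup H] [InnerProductSpace ℂ H]
    [CompleteSpace H] :
    ComplementaryIsometries
      (((WithLp.prodContinuousLinearEquiv 2 ℂ H H).symm : H × H →L[ℂ] WithLp 2 (H × H)) ∘L
        ContinuousLinearMap.inl ℂ H H)
      (((WithLp.prodContinuousLinearEquiv 2 ℂ H H).symm : H × H →L[ℂ] WithLp 2 (H × H)) ∘L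
        ContinuousLinearMap.inr ℂ H H) := by
  have h₁ : (((WithLp.prodContinuousLinearEquiv 2 ℂ H H).symm : H × H →L[ℂ] WithLp 2 (H × H)) ∘L
        ContinuousLinearMap.inl ℂ H H)† = WithLp.fstL 2 ℂ H H := by
    symm
    rw [ContinuousLinearMap.eq_adjoint_iff]
    intro x y
    simp [WithLp.prod_inner_apply]
  have h₂ : (((WithLp.prodContinuousLinearEquiv 2 ℂ H H).symm : H × H →L[ℂ] WithLp 2 (H × H)) ∘L
        ContinuousLinearMap.inr ℂ H H)† = WithLp.sndL 2 ℂ H H := by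
    symm
    rw [ContinuousLinearMap.eq_adjoint_iff]
    intro x y
    simp [WithLp.prod_inner_apply]
  constructor <;> simp only [h₁, h₂]
  · ext x; simp
  · ext x; simp
  · ext x; simp
  · ext x; simp
  · ext x
    rw [← (WithLp.ofLp_injective 2).eq_iff]
    ext <;> simp

/-! ### Domination of a positive operator by its diagonal blocks -/

/-- For complementary projections `a`, `b` a positive `T` is dominated by a
weighted pinching. -/
theorem le_smul_conj_add_smul_conj {R : Type*} [Ring R] [StarRing R] [PartialOrder R]
    [StarOrderedRing R] [Algebra ℝ R] {a b T : R} (ha : IsSelfAdjoint a) (hb : IsSelfAdjoint b)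
    [StarModule ℝ R]
    (hab : a + b = 1) (hT : 0 ≤ T) {δ : ℝ} (hδ : 0 < δ) :
    T ≤ (1 + δ) • (a * T * a) + (1 + δ⁻¹) • (b * T * b) := by
  -- With this `r`, the cross terms of (ra - r⁻¹b) T (ra - r⁻¹b) ≥ 0 are exactly -aTb - bTa,
  -- cancelling those of T = (a+b) T (a+b).
  set r := √δ
  have hr : r * r = δ := Real.mul_self_sqrt hδ.le
  have hr0 : r ≠ 0 := (Real.sqrt_pos.2 hδ).ne'
  have hc : IsSelfAdjoint (r • a - r⁻¹ • b) :=
    (IsSelfAdjoint.smul (.all r) ha).sub (IsSelfAdjoint.smul (.all r⁻¹) hb)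
  have h0 := hc.conjugate_nonneg hT
  have hTe : T = a * T * a + a * T * b + b * T * a + b * T * b := by
    calc T = (a + b) * T * (a + b) := by rw [hab]; simp
      _ = _ := by noncomm_ring
  have he : (r • a - r⁻¹ • b) * T * (r • a - r⁻¹ • b)
      = δ • (a * T * a) - a * T * b - b * T * a + δ⁻¹ • (b * T * b) := by
    simp only [sub_mul, mul_sub, smul_mul_assoc, mul_smul_comm, smul_sub, smul_smul, ← mul_inv, hr,
      mul_inv_cancel₀ hr0, inv_mul_cancel₀ hr0, one_smul]
    abel
  rw [he] at h0
  rw [← sub_nonneg]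
  convert h0 using 1
  nth_rw 3 [hTe]
  simp only [add_smul, one_smul]
  abel

namespace ComplementaryIsometries

variable {H K : Type*} [NormedAddCommGroup H] [InnerProductSpace ℂ H]
    [CompleteSpace H] [NormedAddCommGroup K] [InnerProductSpace ℂ K] [CompleteSpace K]
    {V₁ V₂ : H →L[ℂ] K}

theorem compress_fst_blockDiag (h : ComplementaryIsometries V₁ V₂) (A B : H →L[ℂ] H) :
    V₁† ∘L h.blockDiag (A, B) ∘L V₁ = A := by
  ext x
  simp [blockDiag_apply, h.adjoint_fst_apply_fst, h.adjoint_snd_apply_fst]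

theorem compress_rotate_fst_blockDiag (h : ComplementaryIsometries V₁ V₂) (c s : ℝ)
    (A B : H →L[ℂ] H) :
    (c • V₁ + s • V₂)† ∘L h.blockDiag (A, B) ∘L (c • V₁ + s • V₂) = c ^ 2 • A + s ^ 2 • B := by
  ext x
  simp [blockDiag_apply, adjoint_real_smul, h.adjoint_fst_apply_fst, h.adjoint_snd_apply_fst,
    h.adjoint_fst_apply_snd, h.adjoint_snd_apply_snd, smul_smul, sq]

theorem compress_rotate_snd_blockDiag (h : ComplementaryIsometries V₁ V₂) (c s : ℝ)
    (A B : H →L[ℂ] H) :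
    (c • V₂ - s • V₁)† ∘L h.blockDiag (A, B) ∘L (c • V₂ - s • V₁) = s ^ 2 • A + c ^ 2 • B := by
  ext x
  simp [blockDiag_apply, adjoint_real_smul, h.adjoint_fst_apply_fst, h.adjoint_snd_apply_fst,
    h.adjoint_fst_apply_snd, h.adjoint_snd_apply_snd, smul_smul, sq]
  abel

/-- A positive operator is dominated by multiples of its compressions. -/
theorem le_blockDiag_compress (h : ComplementaryIsometries V₁ V₂) {T : K →L[ℂ] K} (hT : 0 ≤ T)
    {δ : ℝ} (hδ : 0 < δ) :
    T ≤ h.blockDiag ((1 + δ) • (V₁† ∘L T ∘L V₁), (1 + δ⁻¹) • (V₂† ∘L T ∘L V₂)) := by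
  have hsa (V : H →L[ℂ] K) : IsSelfAdjoint (V ∘L V†) := by
    rw [ContinuousLinearMap.isSelfAdjoint_iff', ContinuousLinearMap.adjoint_comp,
      ContinuousLinearMap.adjoint_adjoint]
  refine (le_smul_conj_add_smul_conj (hsa V₁) (hsa V₂) h.add_eq_one hT hδ).trans_eq ?_
  ext x
  simp [blockDiag_apply]

end ComplementaryIsometries

/-! ### From operator monotonicity to operator concavity -/

theorem IsStrictlyPositive.convexCombination {R : Type*} [CStarAlgebra R] [PartialOrder R]
    [StarOrderedRing R] {A B : R}
    (hA : IsStrictlyPositive A) (hB : IsStrictlyPositive B) {w : ℝ} (hw : w ∈ Set.Icc (0 : ℝ) 1) :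
    IsStrictlyPositive ((1 - w) • A + w • B) := by
  rcases hw.1.eq_or_lt with rfl | h0
  · simpa using hA
  · exact .nonneg_add (smul_nonneg (by linarith [hw.2]) hA.nonneg) (hB.smul h0)

theorem IsStrictlyPositive.continuousOn_spectrum {R : Type*} [CStarAlgebra R] [PartialOrder R]
    [StarOrderedRing R] {A : R}
    (hA : IsStrictlyPositive A) {f : ℝ → ℝ} (hf : ContinuousOn f (Set.Ioi 0)) :
    ContinuousOn f (spectrum ℝ A) :=
  hf.mono fun _ hx ↦ hA.spectrum_pos hx

section

variable {H : Type u} [NormedAddCommGroup H] [InnerProductSpace ℂ H] [CompleteSpace H]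
  {f : ℝ → ℝ} {A B : H →L[ℂ] H}

/-- Rotating by the angle with cosine √(1-w) and sine √w makes the convex combination a compression
of A ⊕ B. The factor 1+δ is the price of discarding the off-diagonal blocks. -/
theorem IsOperatorMonotone.convexCombination_cfc_le_cfc_smul (hf : IsOperatorMonotone.{u} f)
    (hA : IsStrictlyPositive A) (hB : IsStrictlyPositive B) {w : ℝ} (hw : w ∈ Set.Icc (0 : ℝ) 1)
    {δ : ℝ} (hδ : 0 < δ) :
    (1 - w) • cfc f A + w • cfc f B ≤ cfc f ((1 + δ) • ((1 - w) • A + w • B)) := by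
  obtain ⟨V₁, V₂, h⟩ : ∃ V₁ V₂ : H →L[ℂ] WithLp 2 (H × H), ComplementaryIsometries V₁ V₂ :=
    ⟨_, _, complementaryIsometries_inl_inr H⟩
  have hc : √(1 - w) ^ 2 = 1 - w := Real.sq_sqrt (by linarith [hw.2])
  have hs : √w ^ 2 = w := Real.sq_sqrt hw.1
  have h' := h.rotate (c := √(1 - w)) (s := √w) (by rw [hc, hs]; ring)
  have hT := h.blockDiag_isStrictlyPositive hA hB
  have hle := h'.le_blockDiag_compress hT.nonneg hδ
  rw [h.compress_rotate_fst_blockDiag, h.compress_rotate_snd_blockDiag, hc, hs] at hle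
  have hX : IsStrictlyPositive ((1 + δ) • ((1 - w) • A + w • B)) :=
    (hA.convexCombination hB hw).smul (by linarith)
  have hY : IsStrictlyPositive ((1 + δ⁻¹) • (w • A + (1 - w) • B)) := by
    rw [add_comm (w • A)]
    exact (hB.convexCombination hA hw).smul (by positivity)
  have key := hf.2 _ _ _ hT (h'.blockDiag_isStrictlyPositive hX hY) hle
  rw [h.cfc_blockDiag f hA.isSelfAdjoint hB.isSelfAdjoint (hf.1.mono
      (Set.union_subset (fun _ hx ↦ hA.spectrum_pos hx) fun _ hx ↦ hB.spectrum_pos hx)),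
    h'.cfc_blockDiag f hX.isSelfAdjoint hY.isSelfAdjoint (hf.1.mono
      (Set.union_subset (fun _ hx ↦ hX.spectrum_pos hx) fun _ hx ↦ hY.spectrum_pos hx)),
    ContinuousLinearMap.le_def] at key
  -- Compression to the first rotated summand removes the block carrying the large factor 1+δ⁻¹.
  have := key.adjoint_conj (√(1 - w) • V₁ + √w • V₂)
  rw [ContinuousLinearMap.sub_comp, ContinuousLinearMap.comp_sub,
    h'.compress_fst_blockDiag, h.compress_rotate_fst_blockDiag, hc, hs] at this
  exact this

theorem tendsto_cfc_one_add_smul (hf : ContinuousOn f (Set.Ioi 0)) (hA : IsStrictlyPositive A) :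
    Filter.Tendsto (fun δ : ℝ ↦ cfc f ((1 + δ) • A)) (nhdsWithin 0 (Set.Ioi 0))
      (nhds (cfc f A)) := by
  have hc : ContinuousOn (fun δ : ℝ ↦ cfc f ((1 + δ) • A)) (Set.Ici 0) := by
    have hpos : ∀ δ ∈ Set.Ici (0 : ℝ), IsStrictlyPositive ((1 + δ) • A) := fun δ hδ ↦
      hA.smul (by linarith [Set.mem_Ici.1 hδ])
    refine ContinuousOn.cfc_of_mem_nhdsSet (s := Set.Ioi 0) f ?_ (by fun_prop)
      (fun δ hδ ↦ (hpos δ hδ).isSelfAdjoint) hf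
    rw [isOpen_Ioi.mem_nhdsSet]
    exact Set.iUnion₂_subset fun δ hδ x hx ↦ (hpos δ hδ).spectrum_pos hx
  have := (hc 0 Set.self_mem_Ici).mono Set.Ioi_subset_Ici_self
  simpa [ContinuousWithinAt] using this

/-- Operator monotone functions on `(0, ∞)` are operator concave. -/
theorem IsOperatorMonotone.convexCombination_cfc_le (hf : IsOperatorMonotone.{u} f)
    (hA : IsStrictlyPositive A) (hB : IsStrictlyPositive B) {w : ℝ} (hw : w ∈ Set.Icc (0 : ℝ) 1) :
    (1 - w) • cfc f A + w • cfc f B ≤ cfc f ((1 - w) • A + w • B) := by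
  refine ge_of_tendsto (tendsto_cfc_one_add_smul hf.1 (hA.convexCombination hB hw)) ?_
  filter_upwards [self_mem_nhdsWithin] with δ hδ
  exact hf.convexCombination_cfc_le_cfc_smul hA hB hw hδ

theorem algebraMap_real_le_iff [Nontrivial H] {a b : ℝ} :
    algebraMap ℝ (H →L[ℂ] H) a ≤ algebraMap ℝ (H →L[ℂ] H) b ↔ a ≤ b := by
  rw [algebraMap_le_iff_le_spectrum (ha := .algebraMap _ (.all _)), spectrum.scalar_eq]
  simp

-- Scalar multiples of the identity turn operator inequalities into scalar ones; `Nontrivial H` is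
-- what lets the order on ℝ be read back.
variable (H) in
theorem IsOperatorMonotone.monotoneOn [Nontrivial H] (hf : IsOperatorMonotone.{u} f) :
    MonotoneOn f (Set.Ioi 0) := fun x hx y hy hxy ↦ by
  have := hf.2 H _ _ (isStrictlyPositive_algebraMap (Set.mem_Ioi.1 hx))
    (isStrictlyPositive_algebraMap (Set.mem_Ioi.1 hy)) (algebraMap_real_le_iff.2 hxy)
  rwa [cfc_algebraMap, cfc_algebraMap, algebraMap_real_le_iff] at this

variable (H) in
theorem IsOperatorMonotone.concaveOn [Nontrivial H] (hf : IsOperatorMonotone.{u} f) :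
    ConcaveOn ℝ (Set.Ioi 0) f := by
  refine ⟨convex_Ioi 0, fun x hx y hy a b ha hb hab ↦ ?_⟩
  obtain rfl : a = 1 - b := by linarith
  have := hf.convexCombination_cfc_le (H := H)
    (isStrictlyPositive_algebraMap (Set.mem_Ioi.1 hx))
    (isStrictlyPositive_algebraMap (Set.mem_Ioi.1 hy)) (w := b) ⟨hb, by linarith⟩
  have he (u v : ℝ) : (1 - b) • algebraMap ℝ (H →L[ℂ] H) u + b • algebraMap ℝ (H →L[ℂ] H) v
      = algebraMap ℝ (H →L[ℂ] H) ((1 - b) • u + b • v) := by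
    simp only [Algebra.algebraMap_eq_smul_one, smul_smul, ← add_smul, smul_eq_mul]
  rwa [cfc_algebraMap, cfc_algebraMap, he, he, cfc_algebraMap, algebraMap_real_le_iff] at this

end

/-! ### Non-negative concave functions on the half-line -/

/-- The point `x` lies between `cx` and `ηx`. Concavity, after dropping the non-negative term at
`ηx`, bounds f(cx); letting η → 0 replaces the endpoint 0, where nothing is assumed of `f`. -/
theorem ConcaveOn.map_mul_le_mul {f : ℝ → ℝ} (hf : ConcaveOn ℝ (Set.Ioi 0) f)
    (hf0 : ∀ x, 0 < x → 0 ≤ f x) {c x : ℝ} (hc : 1 ≤ c) (hx : 0 < x) : f (c * x) ≤ c * f x := by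
  have key : ∀ η ∈ Set.Ioo (0 : ℝ) 1, (1 - η) * f (c * x) ≤ (c - η) * f x := by
    rintro η ⟨h0, h1⟩
    have hcη : 0 < c - η := by linarith
    have hcx : c * x ∈ Set.Ioi 0 := Set.mem_Ioi.2 (by positivity)
    have hηx : η * x ∈ Set.Ioi 0 := Set.mem_Ioi.2 (by positivity)
    have := (And.right hf) hcx hηx (a := (1 - η) / (c - η)) (b := (c - 1) / (c - η))
      (div_nonneg (by linarith) hcη.le) (div_nonneg (by linarith) hcη.le) (by
        field_simp; ring)
    have he : ((1 - η) / (c - η)) • (c * x) + ((c - 1) / (c - η)) • (η * x) = x := by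
      simp only [smul_eq_mul]; field_simp; ring
    rw [he, smul_eq_mul, smul_eq_mul] at this
    have h2 : 0 ≤ (c - 1) / (c - η) * f (η * x) :=
      mul_nonneg (div_nonneg (by linarith) hcη.le) (hf0 _ (by positivity))
    have h3 : (1 - η) / (c - η) * f (c * x) ≤ f x := by linarith
    rwa [div_mul_eq_mul_div, div_le_iff₀ hcη, mul_comm (f x)] at h3
  have h1 : Filter.Tendsto (fun η : ℝ ↦ (1 - η) * f (c * x)) (nhdsWithin 0 (Set.Ioi 0))
      (nhds (f (c * x))) := by
    have : Continuous fun η : ℝ ↦ (1 - η) * f (c * x) := by fun_prop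
    simpa using (this.tendsto 0).mono_left nhdsWithin_le_nhds
  have h2 : Filter.Tendsto (fun η : ℝ ↦ (c - η) * f x) (nhdsWithin 0 (Set.Ioi 0))
      (nhds (c * f x)) := by
    have : Continuous fun η : ℝ ↦ (c - η) * f x := by fun_prop
    simpa using (this.tendsto 0).mono_left nhdsWithin_le_nhds
  refine le_of_tendsto_of_tendsto h1 h2 ?_
  filter_upwards [Ioo_mem_nhdsGT (zero_lt_one' ℝ)] using key

/-- Monotonicity forces zeros to the left of `x`; to the right, the dilation bound with c = y/x
does. -/
theorem ConcaveOn.eqOn_zero_of_eq_zero {f : ℝ → ℝ} (hf : ConcaveOn ℝ (Set.Ioi 0) f)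
    (hmono : MonotoneOn f (Set.Ioi 0)) (hf0 : ∀ x, 0 < x → 0 ≤ f x) {x : ℝ} (hx : 0 < x)
    (hfx : f x = 0) : Set.EqOn f 0 (Set.Ioi 0) := by
  intro y hy
  refine le_antisymm ?_ (hf0 y hy)
  rcases le_total y x with hyx | hxy
  · exact (hmono hy hx hyx).trans_eq hfx
  · have := hf.map_mul_le_mul hf0 ((one_le_div hx).2 hxy) hx
    rwa [div_mul_cancel₀ _ hx.ne', hfx, mul_zero] at this

/-! ### The Kantorovich constant and the scalar reverse AM-GM inequality -/

theorem one_le_kantorovich {h : ℝ} (hh : 0 < h) : 1 ≤ kantorovich h := by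
  rw [kantorovich, one_le_div (by positivity)]
  nlinarith [sq_nonneg (h - 1)]

/-- K decreases on (0, 1] and increases afterwards. Concretely, K(x) > K(s) forces xs > 1, hence xt
> 1, which contradicts K(x) > K(t). -/
theorem kantorovich_le_max {s t x : ℝ} (hs : 0 < s) (hsx : s ≤ x) (hxt : x ≤ t) :
    kantorovich x ≤ max (kantorovich s) (kantorovich t) := by
  have hx : 0 < x := hs.trans_le hsx
  have ht : 0 < t := hx.trans_le hxt
  rw [le_max_iff]
  unfold kantorovich
  by_contra! hcon
  obtain ⟨h1, h2⟩ := hcon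
  rw [div_lt_div_iff₀ (by positivity) (by positivity)] at h1 h2
  have h3 : 0 < (x - s) * (x * s - 1) := by nlinarith
  have h4 : 0 < (x - t) * (x * t - 1) := by nlinarith
  have h5 : 0 < x * s - 1 := pos_of_mul_pos_right h3 (by linarith)
  nlinarith [mul_le_mul_of_nonneg_left (hsx.trans hxt) hx.le]

theorem one_le_kantorovichMax {s t α : ℝ} (hs : 0 < s) (hα : α ∈ Set.Icc (0 : ℝ) 1) :
    1 ≤ kantorovichMax s t α :=
  le_max_of_le_left (Real.one_le_rpow (one_le_kantorovich hs) (le_max_of_le_left hα.1))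

theorem kantorovich_rpow_le_kantorovichMax {s t α x : ℝ} (hα : α ∈ Set.Icc (0 : ℝ) 1)
    (hs : 0 < s) (hsx : s ≤ x) (hxt : x ≤ t) :
    kantorovich x ^ max α (1 - α) ≤ kantorovichMax s t α := by
  have hR : 0 ≤ max α (1 - α) := le_max_of_le_left hα.1
  have hx := zero_le_one.trans (one_le_kantorovich (hs.trans_le hsx))
  rcases le_max_iff.1 (kantorovich_le_max hs hsx hxt) with h | h
  · exact le_max_of_le_left (Real.rpow_le_rpow hx h hR)
  · exact le_max_of_le_right (Real.rpow_le_rpow hx h hR)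

/-- Since α ≤ 1/2, the midpoint (1+x)/2 lies between y = 1-α+αx and `x`. Weighted AM-GM for this
combination, raised to the power 2-2α, gives y x^(1-2α) ≤ ((1+x)/2)^(2-2α), which rearranges to the
claim. -/
theorem arith_le_kantorovich_mul_geom_of_le_half {α x : ℝ} (hα0 : 0 ≤ α) (hα : α ≤ 1 / 2)
    (hx : 0 < x) : 1 - α + α * x ≤ kantorovich x ^ (1 - α) * x ^ α := by
  have hd : 0 < 2 - 2 * α := by linarith
  have hy : 0 < 1 - α + α * x := by nlinarith
  have h := Real.geom_mean_le_arith_mean2_weighted (w₁ := 1 / (2 - 2 * α))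
    (w₂ := (1 - 2 * α) / (2 - 2 * α)) (by positivity) (div_nonneg (by linarith) hd.le) hy.le hx.le
    (by rw [← add_div, div_eq_one_iff_eq hd.ne']; ring)
  have he : 1 / (2 - 2 * α) * (1 - α + α * x) + (1 - 2 * α) / (2 - 2 * α) * x = (x + 1) / 2 := by
    have : 1 - α ≠ 0 := by linarith
    field_simp
    ring
  rw [he] at h
  have h2 := Real.rpow_le_rpow (by positivity) h hd.le
  rw [Real.mul_rpow (by positivity) (by positivity), ← Real.rpow_mul hy.le, ← Real.rpow_mul hx.le,
    div_mul_cancel₀ _ hd.ne', div_mul_cancel₀ _ hd.ne', Real.rpow_one] at h2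
  have hk : kantorovich x ^ (1 - α) = ((x + 1) / 2) ^ (2 - 2 * α) * x ^ (-(1 - α)) := by
    have : kantorovich x = ((x + 1) / 2) ^ (2 : ℝ) * x ^ (-1 : ℝ) := by
      rw [kantorovich, Real.rpow_neg_one, Real.rpow_two]; field_simp; ring
    rw [this, Real.mul_rpow (by positivity) (by positivity), ← Real.rpow_mul (by positivity),
      ← Real.rpow_mul hx.le]
    ring_nf
  rw [hk, mul_assoc, ← Real.rpow_add hx]
  have h3 := mul_le_mul_of_nonneg_right h2 (Real.rpow_nonneg hx.le (-(1 - α) + α))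
  rwa [mul_assoc, ← Real.rpow_add hx, show 1 - 2 * α + (-(1 - α) + α) = 0 by ring,
    Real.rpow_zero, mul_one] at h3

/-- Reverse weighted arithmetic–geometric mean inequality with the Kantorovich constant. -/
theorem arith_le_kantorovich_mul_geom {α x : ℝ} (hα : α ∈ Set.Icc (0 : ℝ) 1) (hx : 0 < x) :
    1 - α + α * x ≤ kantorovich x ^ max α (1 - α) * x ^ α := by
  rcases le_total α (1 / 2) with h | h
  · rw [max_eq_right (by linarith)]
    exact arith_le_kantorovich_mul_geom_of_le_half hα.1 h hx
  · rw [max_eq_left (by linarith)]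
    -- The other half follows from the symmetry (α, x) ↦ (1-α, x⁻¹), which preserves K, after
    -- multiplying by `x`.
    have := arith_le_kantorovich_mul_geom_of_le_half (α := 1 - α) (x := x⁻¹)
      (by linarith [hα.2]) (by linarith) (inv_pos.2 hx)
    have hk : kantorovich x⁻¹ = kantorovich x := by
      unfold kantorovich; field_simp; ring
    rw [hk, sub_sub_cancel, Real.inv_rpow hx.le, ← Real.rpow_neg hx.le] at this
    have h3 := mul_le_mul_of_nonneg_right this hx.le
    have h4 : x ^ (-(1 - α)) * x = x ^ α := by
      nth_rw 2 [← Real.rpow_one x]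
      rw [← Real.rpow_add hx]; ring_nf
    rw [mul_assoc, h4] at h3
    calc 1 - α + α * x = (α + (1 - α) * x⁻¹) * x := by field_simp; ring
      _ ≤ _ := by convert h3 using 2

/-! ### Operator AM-GM inequality and its reverse -/

section

variable {H : Type u} [NormedAddCommGroup H] [InnerProductSpace ℂ H] [CompleteSpace H]
  {f : ℝ → ℝ} {A B : H →L[ℂ] H}

theorem rpow_half_mul_self (hA : IsStrictlyPositive A) :
    A ^ (1 / 2 : ℝ) * A ^ (1 / 2 : ℝ) = A := by
  rw [← CFC.rpow_add hA.isUnit, add_halves, CFC.rpow_one A hA.nonneg]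

theorem rpow_half_mul_rpow_neg_half (hA : IsStrictlyPositive A) :
    A ^ (1 / 2 : ℝ) * A ^ (-1 / 2 : ℝ) = 1 := by
  rw [neg_div]; exact CFC.rpow_mul_rpow_neg _ hA

theorem rpow_neg_half_mul_rpow_half (hA : IsStrictlyPositive A) :
    A ^ (-1 / 2 : ℝ) * A ^ (1 / 2 : ℝ) = 1 := by
  rw [neg_div]; exact CFC.rpow_neg_mul_rpow _ hA

theorem rpow_neg_half_conj_self (hA : IsStrictlyPositive A) :
    A ^ (-1 / 2 : ℝ) * A * A ^ (-1 / 2 : ℝ) = 1 := by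
  rw [neg_div]; exact CFC.conjugate_rpow_neg_one_half A hA

theorem rpow_half_conj_rpow_neg_half_conj (hA : IsStrictlyPositive A) (B : H →L[ℂ] H) :
    A ^ (1 / 2 : ℝ) * (A ^ (-1 / 2 : ℝ) * B * A ^ (-1 / 2 : ℝ)) * A ^ (1 / 2 : ℝ) = B := by
  calc _ = (A ^ (1 / 2 : ℝ) * A ^ (-1 / 2 : ℝ)) * B * (A ^ (-1 / 2 : ℝ) * A ^ (1 / 2 : ℝ)) := by
        noncomm_ring
    _ = B := by rw [rpow_half_mul_rpow_neg_half hA, rpow_neg_half_mul_rpow_half hA]; simp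

/-- With X = A^(-1/2) B A^(-1/2), both means are conjugates by A^(1/2) of functions of `X`, so
comparing them reduces to a scalar inequality on the spectrum of `X`. -/
theorem rpow_half_conj_convexCombination (hA : IsStrictlyPositive A) (B : H →L[ℂ] H) (α : ℝ) :
    A ^ (1 / 2 : ℝ) *
        ((1 - α) • (1 : H →L[ℂ] H) + α • (A ^ (-1 / 2 : ℝ) * B * A ^ (-1 / 2 : ℝ))) *
      A ^ (1 / 2 : ℝ) = (1 - α) • A + α • B := by
  rw [mul_add, add_mul, mul_smul_comm, mul_smul_comm, smul_mul_assoc, smul_mul_assoc, mul_one,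
    rpow_half_mul_self hA, rpow_half_conj_rpow_neg_half_conj hA]

theorem cfc_affine {X : H →L[ℂ] H} (hX : IsSelfAdjoint X) (α : ℝ) :
    cfc (fun x : ℝ ↦ 1 - α + α * x) X = (1 - α) • (1 : H →L[ℂ] H) + α • X := by
  rw [cfc_const_add (1 - α) (fun x ↦ α * x) X, cfc_const_mul_id α X,
    Algebra.algebraMap_eq_smul_one]

theorem isStrictlyPositive_rpow_neg_half_conj (hA : IsStrictlyPositive A)
    (hB : IsStrictlyPositive B) :
    IsStrictlyPositive (A ^ (-1 / 2 : ℝ) * B * A ^ (-1 / 2 : ℝ)) :=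
  hB.conjugate_of_isUnit_of_isSelfAdjoint _ _ (hA.rpow A (-1 / 2)).isUnit
    (hA.rpow A (-1 / 2)).isSelfAdjoint

theorem IsStrictlyPositive.rpow_eq_cfc {X : H →L[ℂ] H} (hX : IsStrictlyPositive X) (α : ℝ) :
    X ^ α = cfc (fun x : ℝ ↦ x ^ α) X ∧ ContinuousOn (fun x : ℝ ↦ x ^ α) (spectrum ℝ X) :=
  ⟨CFC.rpow_eq_cfc_real hX.nonneg, fun _ hx ↦
    (Real.continuousAt_rpow_const _ _ (.inl (hX.spectrum_pos hx).ne')).continuousWithinAt⟩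

/-- The operator arithmetic–geometric mean inequality. -/
theorem geomMean_le_convexCombination (hA : IsStrictlyPositive A) (hB : IsStrictlyPositive B)
    {α : ℝ} (hα : α ∈ Set.Icc (0 : ℝ) 1) : geomMean α A B ≤ (1 - α) • A + α • B := by
  have hX := isStrictlyPositive_rpow_neg_half_conj hA hB
  obtain ⟨he, hc⟩ := hX.rpow_eq_cfc α
  rw [geomMean, ← rpow_half_conj_convexCombination hA]
  refine conjugate_le_conjugate_of_nonneg ?_ CFC.rpow_nonneg
  rw [he, ← cfc_affine hX.isSelfAdjoint]
  refine cfc_mono (fun x hx ↦ ?_) hc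
  have := Real.geom_mean_le_arith_mean2_weighted (w₁ := 1 - α) (w₂ := α) (by linarith [hα.2]) hα.1
    zero_le_one (hX.spectrum_pos hx).le (by ring)
  simpa using this

/-- The reverse operator arithmetic–geometric mean inequality with the Kantorovich constant. -/
theorem convexCombination_le_kantorovichMax_smul_geomMean (hA : IsStrictlyPositive A)
    (hB : IsStrictlyPositive B) {s t : ℝ} (hs : 0 < s) (hsA : s • A ≤ B) (htA : B ≤ t • A)
    {α : ℝ} (hα : α ∈ Set.Icc (0 : ℝ) 1) :
    (1 - α) • A + α • B ≤ kantorovichMax s t α • geomMean α A B := by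
  have hX := isStrictlyPositive_rpow_neg_half_conj hA hB
  obtain ⟨he, hc⟩ := hX.rpow_eq_cfc α
  -- Conjugating sA ≤ B ≤ tA by A^(-1/2) places the spectrum of `X` in [s, t].
  have hsX := conjugate_le_conjugate_of_nonneg hsA (c := A ^ (-1 / 2 : ℝ)) CFC.rpow_nonneg
  have htX := conjugate_le_conjugate_of_nonneg htA (c := A ^ (-1 / 2 : ℝ)) CFC.rpow_nonneg
  rw [mul_smul_comm, smul_mul_assoc, rpow_neg_half_conj_self hA,
    ← Algebra.algebraMap_eq_smul_one] at hsX htX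
  rw [algebraMap_le_iff_le_spectrum hX.isSelfAdjoint] at hsX
  rw [le_algebraMap_iff_spectrum_le hX.isSelfAdjoint] at htX
  have hA₀ : (0 : H →L[ℂ] H) ≤ A ^ (1 / 2 : ℝ) := CFC.rpow_nonneg
  rw [geomMean, ← rpow_half_conj_convexCombination hA, ← smul_mul_assoc (kantorovichMax s t α),
    ← mul_smul_comm (kantorovichMax s t α)]
  refine conjugate_le_conjugate_of_nonneg ?_ hA₀
  rw [he, ← cfc_affine hX.isSelfAdjoint, ← cfc_const_mul _ _ _ hc]
  refine cfc_mono (fun x hx ↦ ?_) (by fun_prop) (hc.const_mul _)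
  exact (arith_le_kantorovich_mul_geom hα (hX.spectrum_pos hx)).trans
    (mul_le_mul_of_nonneg_right (kantorovich_rpow_le_kantorovichMax hα hs (hsX x hx) (htX x hx))
      (Real.rpow_nonneg (hX.spectrum_pos hx).le _))

theorem isStrictlyPositive_geomMean (hA : IsStrictlyPositive A) (hB : IsStrictlyPositive B)
    (α : ℝ) : IsStrictlyPositive (geomMean α A B) :=
  ((isStrictlyPositive_rpow_neg_half_conj hA hB).rpow _ α).conjugate_of_isUnit_of_isSelfAdjoint _ _
    (hA.rpow A (1 / 2)).isUnit (hA.rpow A (1 / 2)).isSelfAdjoint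

theorem geomMean_zero_left (α : ℝ) (B : H →L[ℂ] H) : geomMean α 0 B = 0 := by
  have : (0 : H →L[ℂ] H) ^ (1 / 2 : ℝ) = 0 := CFC.zero_rpow (by norm_num)
  rw [geomMean, this, mul_zero]

theorem isStrictlyPositive_cfc (hA : IsStrictlyPositive A) (hf : ContinuousOn f (Set.Ioi 0))
    (hf0 : ∀ x, 0 < x → 0 < f x) : IsStrictlyPositive (cfc f A) := by
  refine IsUnit.isStrictlyPositive ?_ (cfc_nonneg fun x hx ↦ (hf0 x (hA.spectrum_pos hx)).le)
  exact (isUnit_cfc_iff f A (hA.continuousOn_spectrum hf) hA.isSelfAdjoint).2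
    fun x hx ↦ (hf0 x (hA.spectrum_pos hx)).ne'

end

/-! ### The two inequalities -/

theorem mainTheorem2 {H : Type u} [NormedAddCommGroup H] [InnerProductSpace ℂ H]
    [CompleteSpace H] (f : ℝ → ℝ) (hf : IsOperatorMonotone.{u} f)
    (hf0 : ∀ x : ℝ, 0 < x → 0 ≤ f x)
    (A B : H →L[ℂ] H) (hA : IsStrictlyPositive A)
    (s t : ℝ) (hs : 0 < s) (hst : s ≤ t) (hsA : s • A ≤ B) (htA : B ≤ t • A)
    (α : ℝ) (hα : α ∈ Set.Icc (0 : ℝ) 1) :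
    cfc f (kantorovichMax s t α • geomMean α A B)
        ≤ kantorovichMax s t α • cfc f (geomMean α A B) ∧
      geomMean α (cfc f A) (cfc f B)
        ≤ cfc f (kantorovichMax s t α • geomMean α A B) := by
  rcases subsingleton_or_nontrivial H with hH | hH
  · exact ⟨(Subsingleton.elim _ _).le, (Subsingleton.elim _ _).le⟩
  have hB : IsStrictlyPositive B := (hA.smul hs).of_le hsA
  have hG := isStrictlyPositive_geomMean hA hB α
  set G := geomMean α A B
  set c := kantorovichMax s t α
  have hc : 1 ≤ c := one_le_kantorovichMax hs hα
  have hcG : IsStrictlyPositive (c • G) := hG.smul (zero_lt_one.trans_le hc)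
  have hconc := hf.concaveOn H
  refine ⟨?_, ?_⟩
  · have hcont : ContinuousOn (fun x ↦ f (c * x)) (spectrum ℝ G) :=
      hf.1.comp (by fun_prop) fun x hx ↦
        mul_pos (zero_lt_one.trans_le hc) (hG.spectrum_pos hx)
    have himg : ContinuousOn f ((c * ·) '' spectrum ℝ G) := hf.1.mono <| by
      rintro _ ⟨x, hx, rfl⟩
      exact mul_pos (zero_lt_one.trans_le hc) (hG.spectrum_pos hx)
    rw [← cfc_comp_const_mul c f G himg hG.isSelfAdjoint,
      ← cfc_const_mul c f G (hG.continuousOn_spectrum hf.1)]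
    exact cfc_mono (fun x hx ↦ hconc.map_mul_le_mul hf0 hc (hG.spectrum_pos hx)) hcont
      ((hG.continuousOn_spectrum hf.1).const_mul _)
  · by_cases hpos : ∀ x, 0 < x → 0 < f x
    · calc geomMean α (cfc f A) (cfc f B)
        _ ≤ (1 - α) • cfc f A + α • cfc f B :=
          geomMean_le_convexCombination (isStrictlyPositive_cfc hA hf.1 hpos)
            (isStrictlyPositive_cfc hB hf.1 hpos) hα
        _ ≤ cfc f ((1 - α) • A + α • B) := hf.convexCombination_cfc_le hA hB hα
        _ ≤ cfc f (c • G) := hf.2 H _ _ (hA.convexCombination hB hα) hcG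
          (convexCombination_le_kantorovichMax_smul_geomMean hA hB hs hsA htA hα)
    -- Here f(A) need not be invertible, so AM-GM does not apply. But one zero makes `f` vanish on
    -- all of (0, ∞), so the left side is 0, in line with the convention for 0 ♯ 0.
    · push Not at hpos
      obtain ⟨x, hx, hfx⟩ := hpos
      have hzero := hconc.eqOn_zero_of_eq_zero (hf.monotoneOn H) hf0 hx (hfx.antisymm (hf0 x hx))
      have hA0 : cfc f A = 0 := by
        rw [cfc_congr (g := 0) fun y hy ↦ hzero (hA.spectrum_pos hy)]
        exact cfc_zero ℝ A
      rw [hA0, geomMean_zero_left]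
      exact cfc_nonneg fun y hy ↦ hf0 y (hcG.spectrum_pos hy)
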